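/- Let $d>1$ be a square-free integer, let $K_d=\mathbb{Q}(\sqrt d)$, and let $h_d$ be the class number of $K_d$. Suppose that exactly two rational primes ramify in $K_d$ and that $h_d\in\{1,2\}$. Let $p_1$ be the smallest rational prime that ramifies in $K_d$. If $p_1\equiv 1 \pmod 4$, then $h_d=2$. If $p_1\equiv 3\pmod 4$, then $h_d=1$. -/

import Mathlib

open scoped NumberField

/-- The quadratic field `ℚ(√d)`, as a subfield of `ℂ` (it is generated by both square roots of
`d`, so no choice of a square root is involved). -/
noncomputable def quadField (d : ℤ) : IntermediateField ℚ ℂ :=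
  IntermediateField.adjoin ℚ {z : ℂ | z ^ 2 = (d : ℂ)}

theorem finiteDimensional_quadField (d : ℤ) : FiniteDimensional ℚ (quadField d) := by
  have hp : (Polynomial.X ^ 2 - Polynomial.C (d : ℂ)) ≠ 0 :=
    Polynomial.X_pow_sub_C_ne_zero (by norm_num) _
  have hfin : Set.Finite {z : ℂ | z ^ 2 = (d : ℂ)} := by
    refine (Polynomial.finite_setOfPred_isRoot hp).subset ?_
    intro z hz
    have hz' : z ^ 2 = (d : ℂ) := hz
    simp [Polynomial.IsRoot, hz']
  have := hfin.to_subtype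
  refine IntermediateField.finiteDimensional_adjoin (fun z hz => ?_)
  have hz' : z ^ 2 = (d : ℂ) := hz
  refine ⟨Polynomial.X ^ 2 - Polynomial.C (d : ℚ),
    Polynomial.monic_X_pow_sub_C _ (by norm_num), ?_⟩
  rw [Polynomial.eval₂_sub, Polynomial.eval₂_pow, Polynomial.eval₂_X, Polynomial.eval₂_C, hz']
  simp

instance numberField_quadField (d : ℤ) : NumberField (quadField d) where
  to_charZero := inferInstance
  to_finiteDimensional := finiteDimensional_quadField d

/-- The class number `h_d` of `ℚ(√d)`. -/
noncomputable def quadClassNumber (d : ℤ) : ℕ :=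
  NumberField.classNumber (quadField d)

/-- The set of rational primes which ramify in the number field `K`: some prime ideal of `𝓞 K`
above `p` is ramified over `ℤ`. -/
def ramifiedPrimes (K : Type*) [Field K] [NumberField K] : Set ℕ :=
  {p : ℕ | p.Prime ∧ ¬ Algebra.IsUnramifiedIn (𝓞 K) (Ideal.span {(p : ℤ)})}

/-! Both claims concern an odd least ramified prime p. Then d = D = 4m + 1 = pq, and the ring of
integers is ℤ[ω] with ω² = m + ω. Write x' for the conjugate of x, and P = (p, √D), Q = (q, √D), so
that PQ = (√D).

Case p ≡ 1 mod 4. Then q ≡ 1 as well, so D = a² + b² and a + √D has norm -b². If ℤ[ω] were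
principal, this would produce a unit of norm -1 (`exists_unit_norm_eq_neg_one`). The fundamental
unit would then have norm -1, and every unit of norm 1 would be a square up to sign. So P would have
a generator whose square is ±p, against `sq_ne_prime`.

Case p ≡ 3 mod 4. Now -1 is not a norm from the field, so the fundamental unit ε has norm 1 and (1 +
ε) is stable under conjugation. A nonzero stable ideal is a rational multiple of some (a, √D) with a
∣ pq. Here a = 1 or a = pq would make ε a square up to sign, so P and Q are principal, and with them
all stable ideals. If the class number were 2, a nonprincipal I would have I·I and I·I' principal,
and Hilbert 90 would put a stable ideal in the class of I, a contradiction. -/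

/-! ### Conjugation-stable ideals of ℤ[ω] -/

namespace QuadraticAlgebra

variable {m : ℤ}

/-- The square root of the discriminant `4 * m + 1` in `ℤ[ω]`, where `ω ^ 2 = m + ω`. -/
def sqrtDisc (m : ℤ) : QuadraticAlgebra ℤ m 1 := ⟨-1, 2⟩

theorem sqrtDisc_mul_self : sqrtDisc m * sqrtDisc m = ((4 * m + 1 : ℤ) : QuadraticAlgebra ℤ m 1) := by
  ext <;> simp [sqrtDisc]; ring

theorem star_sqrtDisc : star (sqrtDisc m) = -sqrtDisc m := by
  ext <;> simp [sqrtDisc]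

theorem star_intCast_eq (n : ℤ) : star (n : QuadraticAlgebra ℤ m 1) = n := by
  ext <;> simp

theorem mul_star_eq_norm (x : QuadraticAlgebra ℤ m 1) : x * star x = (norm x : ℤ) := by
  rw [← algebraMap_norm_eq_mul_star]; rfl

/-- A nonzero ideal stable under conjugation is a rational multiple of `(a, √D)` with `a ∣ D`. -/
theorem exists_eq_span_mul_span_of_star_mem {J : Ideal (QuadraticAlgebra ℤ m 1)} (hJ : J ≠ ⊥)
    (hs : ∀ x ∈ J, star x ∈ J) :
    ∃ (e : ℤ) (a : ℕ), e ≠ 0 ∧ (a : ℤ) ∣ 4 * m + 1 ∧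
      J = Ideal.span {(e : QuadraticAlgebra ℤ m 1)} *
        Ideal.span {((a : ℤ) : QuadraticAlgebra ℤ m 1), sqrtDisc m} := by
  -- T collects the ω-coordinates of J, and Z is J ∩ ℤ. Their generators e and f lead to the ℤ-basis
  -- f = ea, g = e(b + ω) of J.
  let T : Ideal ℤ := (J.restrictScalars ℤ).map (imₗ (R := ℤ) (a := m) (b := 1))
  let Z : Ideal ℤ := J.comap (Int.castRingHom (QuadraticAlgebra ℤ m 1))
  obtain ⟨e, he⟩ : ∃ e, T = Ideal.span {e} := (IsPrincipalIdealRing.principal T).1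
  obtain ⟨f, hf⟩ : ∃ f, Z = Ideal.span {f} := (IsPrincipalIdealRing.principal Z).1
  have him : ∀ x ∈ J, e ∣ x.im := fun x hx => by
    rw [← Ideal.mem_span_singleton, ← he]
    exact ⟨x, hx, rfl⟩
  have hre : ∀ x ∈ J, e ∣ x.re := fun x hx => by
    have h1 := him _ (J.mul_mem_left ω hx)
    have h2 := him x hx
    simp only [im_mul, omega_re, omega_im] at h1
    have := dvd_sub h1 h2
    simpa using this
  have hZ : ∀ n : ℤ, (n : QuadraticAlgebra ℤ m 1) ∈ J ↔ f ∣ n := fun n => by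
    rw [← Ideal.mem_span_singleton, ← hf]; rfl
  have he0 : e ≠ 0 := by
    rintro rfl
    refine hJ ((Submodule.eq_bot_iff _).2 fun x hx => ?_)
    ext
    · simpa using hre x hx
    · simpa using him x hx
  obtain ⟨g, hg, hge⟩ : ∃ g ∈ J, g.im = e := by
    have : e ∈ T := by rw [he]; exact Ideal.mem_span_singleton_self e
    exact this
  obtain ⟨b, hb⟩ := hre g hg
  have hg' : g = e * ⟨b, 1⟩ := by ext <;> simp [hb, hge]
  obtain ⟨a, ha⟩ : e ∣ f := by
    have : (f : QuadraticAlgebra ℤ m 1) ∈ J := (hZ f).2 dvd_rfl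
    simpa using hre _ this
  -- The trace and the norm of b + ω, multiplied by e, lie in J ∩ ℤ = (ea), and D is trace² -
  -- 4·norm.
  have ha1 : a ∣ 2 * b + 1 := by
    have h1 := J.add_mem hg (hs g hg)
    have h2 : g + star g = ((e * (2 * b + 1) : ℤ) : QuadraticAlgebra ℤ m 1) := by
      rw [hg']; ext <;> simp; ring
    rw [h2, hZ, ha] at h1
    exact (mul_dvd_mul_iff_left he0).1 h1
  have ha2 : a ∣ b * b + b - m := by
    have h1 := J.mul_mem_left ⟨b + 1, -1⟩ hg
    have h2 : (⟨b + 1, -1⟩ : QuadraticAlgebra ℤ m 1) * g =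
        ((e * (b * b + b - m) : ℤ) : QuadraticAlgebra ℤ m 1) := by
      rw [hg']; ext <;> simp <;> ring
    rw [h2, hZ, ha] at h1
    exact (mul_dvd_mul_iff_left he0).1 h1
  have haD : a ∣ 4 * m + 1 := by
    have : 4 * m + 1 = (2 * b + 1) * (2 * b + 1) - 4 * (b * b + b - m) := by ring
    rw [this]
    exact dvd_sub (ha1.mul_left _) (ha2.mul_left _)
  obtain ⟨c, hc⟩ := ha1
  have hodd : Odd a := by
    have : Odd (a * c) := by rw [← hc]; exact ⟨b, rfl⟩
    exact (Int.odd_mul.1 this).1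
  obtain ⟨k, hk⟩ := hodd
  refine ⟨e, a.natAbs, he0, by simpa using haD, ?_⟩
  have hspan : Ideal.span {((a.natAbs : ℤ) : QuadraticAlgebra ℤ m 1), sqrtDisc m} =
      Ideal.span {(a : QuadraticAlgebra ℤ m 1), sqrtDisc m} := by
    rcases Int.natAbs_eq a with h | h
    · rw [← h]
    · rw [Ideal.span_insert, Ideal.span_insert, ← Ideal.span_singleton_neg, ← Int.cast_neg, ← h]
  rw [hspan]
  have hba : (⟨b, 1⟩ : QuadraticAlgebra ℤ m 1) ∈
      Ideal.span {(a : QuadraticAlgebra ℤ m 1), sqrtDisc m} := by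
    rw [Ideal.mem_span_pair]
    -- Since a = 2k + 1 and 2(b + ω) = ac + √D, one has b + ω = a(b + ω) - k(ac + √D).
    refine ⟨⟨b, 1⟩ - ((k * c : ℤ) : QuadraticAlgebra ℤ m 1), -(k : QuadraticAlgebra ℤ m 1), ?_⟩
    ext
    · simp [sqrtDisc]
      linear_combination k * hc + b * hk
    · simp [sqrtDisc]
      linear_combination hk
  refine le_antisymm (fun x hx => ?_) ?_
  · obtain ⟨r, hr⟩ := hre x hx
    obtain ⟨s, hs⟩ := him x hx
    have h1 := J.sub_mem hx (J.mul_mem_left (s : QuadraticAlgebra ℤ m 1) hg)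
    have h2 : x - (s : QuadraticAlgebra ℤ m 1) * g =
        ((e * (r - s * b) : ℤ) : QuadraticAlgebra ℤ m 1) := by
      rw [hg']; ext <;> simp [hr, hs] <;> ring
    rw [h2, hZ, ha, mul_dvd_mul_iff_left he0] at h1
    obtain ⟨t, ht⟩ := h1
    rw [Ideal.mem_span_singleton_mul]
    refine ⟨s * ⟨b, 1⟩ + t * a, Ideal.add_mem _ (Ideal.mul_mem_left _ _ hba)
      (Ideal.mul_mem_left _ _ (Ideal.subset_span (by simp))), ?_⟩
    ext
    · simp [hr]
      exact Or.inl (by linear_combination -ht)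
    · simp [hs]
  · rw [Ideal.span_mul_span, Ideal.span_le]
    rintro _ ⟨_, rfl, y, hy, rfl⟩
    rcases hy with rfl | rfl
    · have : (f : QuadraticAlgebra ℤ m 1) ∈ J := (hZ f).2 dvd_rfl
      simpa [ha] using this
    · have h1 := J.sub_mem (J.mul_mem_left 2 hg)
        ((hZ (e * (2 * b + 1))).2 (by rw [ha, hc, ← mul_assoc]; exact dvd_mul_right _ _))
      have h2 : (e : QuadraticAlgebra ℤ m 1) * sqrtDisc m ∈ J := by
        convert h1 using 1
        rw [hg']
        ext <;> simp [sqrtDisc] <;> ring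
      exact h2

end QuadraticAlgebra

/-! ### The ideals (a, √D) and units of norm 1 -/

namespace QuadraticAlgebra

variable {m : ℤ}

/-- The ideal `(a, √D)` of `ℤ[ω]`, for `D = 4 * m + 1`. -/
def discIdeal (m a : ℤ) : Ideal (QuadraticAlgebra ℤ m 1) :=
  Ideal.span {(a : QuadraticAlgebra ℤ m 1), sqrtDisc m}

theorem discIdeal_one : discIdeal m 1 = ⊤ := by
  rw [Ideal.eq_top_iff_one]
  exact Ideal.subset_span (by simp)

theorem discIdeal_self : discIdeal m (4 * m + 1) = Ideal.span {sqrtDisc m} := by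
  refine le_antisymm (Ideal.span_le.2 ?_) (Ideal.span_mono (by simp))
  rintro _ (rfl | rfl)
  · rw [← sqrtDisc_mul_self]
    exact Ideal.mul_mem_left _ _ (Ideal.mem_span_singleton_self _)
  · exact Ideal.mem_span_singleton_self _

/-- All generators of the product are multiples of √D, and 1 = up + vq recovers √D from p√D and q√D.
-/
theorem discIdeal_mul {p q : ℤ} (h : p * q = 4 * m + 1) (hc : IsCoprime p q) :
    discIdeal m p * discIdeal m q = Ideal.span {sqrtDisc m} := by
  have hpq : (p : QuadraticAlgebra ℤ m 1) * q = sqrtDisc m * sqrtDisc m := by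
    rw [sqrtDisc_mul_self, ← h]; push_cast; rfl
  obtain ⟨u, v, huv⟩ := hc
  have huv' : (u : QuadraticAlgebra ℤ m 1) * p + v * q = 1 := by
    exact_mod_cast congrArg (Int.cast : ℤ → QuadraticAlgebra ℤ m 1) huv
  rw [discIdeal, discIdeal, Ideal.span_pair_mul_span_pair]
  refine le_antisymm (Ideal.span_le.2 ?_) ?_
  · rintro _ (rfl | rfl | rfl | rfl)
    · rw [hpq]; exact Ideal.mul_mem_left _ _ (Ideal.mem_span_singleton_self _)
    · exact Ideal.mul_mem_left _ _ (Ideal.mem_span_singleton_self _)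
    · exact Ideal.mul_mem_right _ _ (Ideal.mem_span_singleton_self _)
    · exact Ideal.mul_mem_right _ _ (Ideal.mem_span_singleton_self _)
  · rw [Ideal.span_singleton_le_iff_mem]
    have : sqrtDisc m = u * (p * sqrtDisc m) + v * (sqrtDisc m * q) := by
      linear_combination (-sqrtDisc m) * huv'
    exact (congrArg (· ∈ _) this).mpr <|
      Ideal.add_mem _ (Ideal.mul_mem_left _ _ (Ideal.subset_span (by simp)))
        (Ideal.mul_mem_left _ _ (Ideal.subset_span (by simp)))

/-- This is the ramification of p: 1 = up + vq gives p = u·p² + v·D. -/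
theorem discIdeal_mul_self {p q : ℤ} (h : p * q = 4 * m + 1) (hc : IsCoprime p q) :
    discIdeal m p * discIdeal m p = Ideal.span {(p : QuadraticAlgebra ℤ m 1)} := by
  have hpq : (p : QuadraticAlgebra ℤ m 1) * q = sqrtDisc m * sqrtDisc m := by
    rw [sqrtDisc_mul_self, ← h]; push_cast; rfl
  obtain ⟨u, v, huv⟩ := hc
  have huv' : (u : QuadraticAlgebra ℤ m 1) * p + v * q = 1 := by
    exact_mod_cast congrArg (Int.cast : ℤ → QuadraticAlgebra ℤ m 1) huv
  rw [discIdeal, Ideal.span_pair_mul_span_pair]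
  refine le_antisymm (Ideal.span_le.2 ?_) ?_
  · rintro _ (rfl | rfl | rfl | rfl)
    · exact Ideal.mul_mem_left _ _ (Ideal.mem_span_singleton_self _)
    · exact Ideal.mul_mem_right _ _ (Ideal.mem_span_singleton_self _)
    · exact Ideal.mul_mem_left _ _ (Ideal.mem_span_singleton_self _)
    · rw [← hpq]; exact Ideal.mul_mem_right _ _ (Ideal.mem_span_singleton_self _)
  · rw [Ideal.span_singleton_le_iff_mem]
    have : (p : QuadraticAlgebra ℤ m 1) = u * (p * p) + v * (sqrtDisc m * sqrtDisc m) := by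
      linear_combination (-p : QuadraticAlgebra ℤ m 1) * huv' + v * hpq
    exact (congrArg (· ∈ _) this).mpr <|
      Ideal.add_mem _ (Ideal.mul_mem_left _ _ (Ideal.subset_span (by simp)))
        (Ideal.mul_mem_left _ _ (Ideal.subset_span (by simp)))

theorem norm_units (v : (QuadraticAlgebra ℤ m 1)ˣ) :
    norm (v : QuadraticAlgebra ℤ m 1) = 1 ∨ norm (v : QuadraticAlgebra ℤ m 1) = -1 :=
  Int.isUnit_iff.1 (v.isUnit.map norm)

/-- A unit `u` with `u * v' = ± v` for a unit `v` with conjugate `v'` is `± v ^ 2`. -/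
theorem eq_sq_or_eq_neg_sq_of_mul_star {u v : (QuadraticAlgebra ℤ m 1)ˣ}
    (h : (u * star (v : QuadraticAlgebra ℤ m 1) : QuadraticAlgebra ℤ m 1) = v ∨
      (u * star (v : QuadraticAlgebra ℤ m 1) : QuadraticAlgebra ℤ m 1) = -v) :
    u = v ^ 2 ∨ u = -v ^ 2 := by
  have hn := mul_star_eq_norm (v : QuadraticAlgebra ℤ m 1)
  rcases h with h | h <;> rcases norm_units v with h1 | h1 <;> rw [h1] at hn <;> push_cast at hn
  · exact .inl <| Units.ext <| by push_cast; linear_combination v * h - u * hn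
  · exact .inr <| Units.ext <| by push_cast; linear_combination -v * h + u * hn
  · exact .inr <| Units.ext <| by push_cast; linear_combination v * h - u * hn
  · exact .inl <| Units.ext <| by push_cast; linear_combination -v * h + u * hn

/-- If P = (x), then √D = xy for some y, and cancelling x in PQ = (√D) leaves Q = (y). -/
theorem exists_discIdeal_eq_span_of_mul [IsDomain (QuadraticAlgebra ℤ m 1)] {p q : ℤ}
    (h : p * q = 4 * m + 1) (hc : IsCoprime p q) (hp : ∃ x, discIdeal m p = Ideal.span {x}) :
    ∃ x, discIdeal m q = Ideal.span {x} := by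
  obtain ⟨x, hx⟩ := hp
  have hpq := discIdeal_mul h hc
  have hδ : sqrtDisc m ≠ 0 := fun h0 => by simpa [sqrtDisc] using congrArg im h0
  have hmem : sqrtDisc m ∈ Ideal.span {x} := by
    rw [← hx]; exact Ideal.subset_span (by simp)
  obtain ⟨y, hy⟩ := Ideal.mem_span_singleton.1 hmem
  have hx0 : x ≠ 0 := by rintro rfl; exact hδ (by simpa using hy)
  refine ⟨y, ?_⟩
  rw [hx, hy, ← Ideal.span_singleton_mul_span_singleton] at hpq
  exact (Ideal.span_singleton_mul_right_inj hx0).1 hpq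

theorem eq_one_or_of_dvd_mul_prime {a p q : ℕ} (hp : p.Prime) (hq : q.Prime) (h : a ∣ p * q) :
    a = 1 ∨ a = p ∨ a = q ∨ a = p * q := by
  obtain ⟨x, y, hx, hy, rfl⟩ := (Nat.dvd_mul).1 h
  rcases (Nat.dvd_prime hp).1 hx with rfl | rfl <;>
    rcases (Nat.dvd_prime hq).1 hy with rfl | rfl <;> simp

/-- If `D = p * q` and some unit of norm `1` is not a square up to sign, then the primes above `p`
and `q` are principal. -/
theorem exists_discIdeal_eq_span [IsDomain (QuadraticAlgebra ℤ m 1)] {p q : ℕ}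
    (hp : p.Prime) (hq : q.Prime) (hne : p ≠ q) (h : (p * q : ℤ) = 4 * m + 1)
    {u : (QuadraticAlgebra ℤ m 1)ˣ} (hu : norm (u : QuadraticAlgebra ℤ m 1) = 1)
    (hsq : ∀ v : (QuadraticAlgebra ℤ m 1)ˣ, u ≠ v ^ 2 ∧ u ≠ -v ^ 2) :
    (∃ x, discIdeal m p = Ideal.span {x}) ∧ (∃ x, discIdeal m q = Ideal.span {x}) := by
  have hc : IsCoprime (p : ℤ) q := Nat.isCoprime_iff_coprime.2 ((Nat.coprime_primes hp hq).2 hne)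
  have huu : (u : QuadraticAlgebra ℤ m 1) * star (u : QuadraticAlgebra ℤ m 1) = 1 := by
    rw [mul_star_eq_norm, hu, Int.cast_one]
  -- If 1 + u = xv with v a unit and x' = ±x, then u(1 + u)' = 1 + u becomes uv' = ±v.
  have key : ∀ {x : QuadraticAlgebra ℤ m 1}, (∃ v : (QuadraticAlgebra ℤ m 1)ˣ, x * v = 1 + u) →
      x ≠ 0 → (star x = x ∨ star x = -x) → False := by
    rintro x ⟨v, hv⟩ hx hxs
    have hvs := congrArg star hv
    simp only [star_mul, star_add, star_one] at hvs
    have h2 : x * v = u * (star (v : QuadraticAlgebra ℤ m 1) * star x) := by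
      rw [hv, hvs, mul_add, huu, mul_one, add_comm]
    have := eq_sq_or_eq_neg_sq_of_mul_star (u := u) (v := v) <| by
      refine hxs.imp (fun hs => mul_left_cancel₀ hx ?_) (fun hs => mul_left_cancel₀ hx ?_) <;>
      rw [hs] at h2
      · linear_combination -h2
      · linear_combination h2
    exact this.elim (hsq v).1 (hsq v).2
  have hγ : (1 + u : QuadraticAlgebra ℤ m 1) ≠ 0 := fun h0 =>
    (hsq 1).2 (Units.ext (by push_cast; linear_combination h0))
  obtain ⟨e, a, he, ha, hJ⟩ := exists_eq_span_mul_span_of_star_mem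
    (J := Ideal.span {(1 + u : QuadraticAlgebra ℤ m 1)}) (by simpa using hγ) (fun x hx => by
      obtain ⟨y, rfl⟩ := Ideal.mem_span_singleton.1 hx
      refine Ideal.mem_span_singleton.2 ⟨star (u : QuadraticAlgebra ℤ m 1) * star y, ?_⟩
      simp only [star_mul, star_add, star_one]
      linear_combination (-star y) * huu)
  change _ = _ * discIdeal m a at hJ
  have he' : (e : QuadraticAlgebra ℤ m 1) ≠ 0 := Int.cast_ne_zero.2 he
  have hprin : ∃ x, discIdeal m a = Ideal.span {x} := by
    have : (1 + u : QuadraticAlgebra ℤ m 1) ∈ Ideal.span {(e : QuadraticAlgebra ℤ m 1)} :=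
      Ideal.mul_le_left (J := discIdeal m a)
        (by rw [← hJ]; exact Ideal.mem_span_singleton_self _)
    obtain ⟨y, hy⟩ := Ideal.mem_span_singleton.1 this
    rw [hy, ← Ideal.span_singleton_mul_span_singleton] at hJ
    exact ⟨y, ((Ideal.span_singleton_mul_right_inj he').1 hJ).symm⟩
  have hpq1 := fun hx => exists_discIdeal_eq_span_of_mul h hc hx
  have hpq2 := fun hx => exists_discIdeal_eq_span_of_mul (by rw [mul_comm]; exact h) hc.symm hx
  rw [← h] at ha
  -- For a = 1 or a = pq, 1 + u is associated to e or e√D, which `key` excludes.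
  rcases eq_one_or_of_dvd_mul_prime hp hq (by exact_mod_cast ha) with rfl | rfl | rfl | rfl
  · rw [Nat.cast_one, discIdeal_one, Ideal.mul_top] at hJ
    exact (key (Ideal.span_singleton_eq_span_singleton.1 hJ.symm) he'
      (.inl (star_intCast_eq e))).elim
  · exact ⟨hprin, hpq1 hprin⟩
  · exact ⟨hpq2 hprin, hprin⟩
  · rw [Nat.cast_mul, h, discIdeal_self, Ideal.span_singleton_mul_span_singleton] at hJ
    refine (key (Ideal.span_singleton_eq_span_singleton.1 hJ.symm) (mul_ne_zero he' ?_) ?_).elim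
    · exact fun h0 => by simpa [sqrtDisc] using congrArg im h0
    · right
      rw [star_mul, star_intCast_eq, star_sqrtDisc]
      ring

theorem exists_eq_span_of_star_mem {p q : ℕ} (hp : p.Prime) (hq : q.Prime)
    (h : (p * q : ℤ) = 4 * m + 1) (h1 : ∃ x, discIdeal m p = Ideal.span {x})
    (h2 : ∃ x, discIdeal m q = Ideal.span {x}) {J : Ideal (QuadraticAlgebra ℤ m 1)}
    (hs : ∀ x ∈ J, star x ∈ J) : ∃ x, J = Ideal.span {x} := by
  by_cases hJ : J = ⊥
  · exact ⟨0, by simp [hJ]⟩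
  obtain ⟨e, a, -, ha, rfl⟩ := exists_eq_span_mul_span_of_star_mem hJ hs
  change ∃ x, _ * discIdeal m a = _
  suffices ∃ x, discIdeal m a = Ideal.span {x} by
    obtain ⟨x, hx⟩ := this
    exact ⟨e * x, by rw [hx, Ideal.span_singleton_mul_span_singleton]⟩
  rw [← h] at ha
  rcases eq_one_or_of_dvd_mul_prime hp hq (by exact_mod_cast ha) with rfl | rfl | rfl | rfl
  · exact ⟨1, by simp [discIdeal_one]⟩
  · exact h1
  · exact h2
  · exact ⟨sqrtDisc m, by rw [Nat.cast_mul, h, discIdeal_self]⟩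

end QuadraticAlgebra

/-! ### Conjugate ideals and Hilbert 90 -/

namespace QuadraticAlgebra

variable {m : ℤ}

/-- Conjugation of ideals. -/
def conjIdeal (I : Ideal (QuadraticAlgebra ℤ m 1)) : Ideal (QuadraticAlgebra ℤ m 1) :=
  I.map (starRingEnd (QuadraticAlgebra ℤ m 1))

theorem conjIdeal_conjIdeal (I : Ideal (QuadraticAlgebra ℤ m 1)) : conjIdeal (conjIdeal I) = I := by
  rw [conjIdeal, conjIdeal, Ideal.map_map]
  convert Ideal.map_id I
  ext x <;> simp

theorem conjIdeal_mul (I J : Ideal (QuadraticAlgebra ℤ m 1)) :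
    conjIdeal (I * J) = conjIdeal I * conjIdeal J := Ideal.map_mul _ _ _

theorem conjIdeal_span_singleton (x : QuadraticAlgebra ℤ m 1) :
    conjIdeal (Ideal.span {x}) = Ideal.span {star x} := by
  simp [conjIdeal, Ideal.map_span, starRingEnd_apply]

theorem star_mem_conjIdeal {I : Ideal (QuadraticAlgebra ℤ m 1)} {x} (hx : x ∈ I) :
    star x ∈ conjIdeal I := Ideal.mem_map_of_mem (starRingEnd (QuadraticAlgebra ℤ m 1)) hx

theorem norm_ne_zero [IsDomain (QuadraticAlgebra ℤ m 1)] {x : QuadraticAlgebra ℤ m 1}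
    (hx : x ≠ 0) : norm x ≠ 0 := fun h => by
  have h1 := mul_star_eq_norm x
  rw [h, Int.cast_zero] at h1
  rcases mul_eq_zero.1 h1 with h2 | h2
  · exact hx h2
  · exact hx (star_eq_zero.1 h2)

/-- Multiplication by an integer determines that integer up to divisibility. -/
theorem dvd_of_span_intCast_mul_eq {I : Ideal (QuadraticAlgebra ℤ m 1)} {r s : ℤ}
    [IsDomain (QuadraticAlgebra ℤ m 1)] (hI : I ≠ ⊥)
    (h : Ideal.span {(r : QuadraticAlgebra ℤ m 1)} * I = Ideal.span {(s : QuadraticAlgebra ℤ m 1)} * I) :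
    s ∣ r := by
  obtain ⟨x, hx, hx0⟩ := Submodule.exists_mem_ne_zero_of_ne_bot hI
  obtain ⟨f, hf⟩ : ∃ f, I.comap (Int.castRingHom (QuadraticAlgebra ℤ m 1)) = Ideal.span {f} :=
    (IsPrincipalIdealRing.principal _).1
  have hZ : ∀ n : ℤ, (n : QuadraticAlgebra ℤ m 1) ∈ I ↔ f ∣ n := fun n => by
    rw [← Ideal.mem_span_singleton, ← hf]; rfl
  have hf0 : f ≠ 0 := by
    rintro rfl
    have := I.mul_mem_right (star x) hx
    rw [mul_star_eq_norm, hZ, zero_dvd_iff] at this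
    exact norm_ne_zero hx0 this
  have hmem : (r : QuadraticAlgebra ℤ m 1) * f ∈ Ideal.span {(s : QuadraticAlgebra ℤ m 1)} * I := by
    rw [← h]
    exact Ideal.mul_mem_mul (Ideal.mem_span_singleton_self _) ((hZ f).2 dvd_rfl)
  -- In rf = sy with y ∈ I, either s = 0 or y is an integer, hence a multiple of f.
  obtain ⟨y, hy, hsy⟩ := Ideal.mem_span_singleton_mul.1 hmem
  have hre : s * y.re = r * f := by simpa using congrArg re hsy
  have him : s = 0 ∨ y.im = 0 := by simpa using congrArg im hsy
  rcases him with rfl | him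
  · rw [zero_mul, zero_eq_mul] at hre
    simp [hre.resolve_right hf0]
  · have hy' : y = (y.re : QuadraticAlgebra ℤ m 1) := by ext <;> simp [him]
    rw [hy', hZ] at hy
    obtain ⟨k, hk⟩ := hy
    refine ⟨k, mul_right_cancel₀ hf0 ?_⟩
    rw [← hre, hk]; ring

/-- If conjugate ideals differ by a principal ideal and `-1` is not a norm, then the class contains
a conjugation-stable ideal (Hilbert's Theorem 90). -/
theorem exists_star_mem_of_span_mul_eq [IsDomain (QuadraticAlgebra ℤ m 1)]
    (hneg : ∀ (x : QuadraticAlgebra ℤ m 1) (n : ℤ), norm x = -n ^ 2 → n = 0)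
    {I : Ideal (QuadraticAlgebra ℤ m 1)} (hI : I ≠ ⊥) {a c : QuadraticAlgebra ℤ m 1}
    (ha : a ≠ 0) (hc : c ≠ 0) (h : Ideal.span {c} * I = Ideal.span {a} * conjIdeal I) :
    ∃ g : QuadraticAlgebra ℤ m 1, g ≠ 0 ∧
      ∀ x ∈ Ideal.span {g} * I, star x ∈ Ideal.span {g} * I := by
  have hsc : star c ≠ 0 := star_ne_zero.2 hc
  have h' : Ideal.span {star c} * conjIdeal I = Ideal.span {star a} * I := by
    have := congrArg conjIdeal h
    rwa [conjIdeal_mul, conjIdeal_mul, conjIdeal_conjIdeal, conjIdeal_span_singleton,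
      conjIdeal_span_singleton] at this
  have hN : Ideal.span {((norm c : ℤ) : QuadraticAlgebra ℤ m 1)} * I =
      Ideal.span {((norm a : ℤ) : QuadraticAlgebra ℤ m 1)} * I := by
    rw [← mul_star_eq_norm, ← mul_star_eq_norm, ← Ideal.span_singleton_mul_span_singleton,
      ← Ideal.span_singleton_mul_span_singleton, mul_comm (Ideal.span {c}), mul_assoc, h,
      mul_left_comm, h', mul_assoc]
  have hassoc := Int.associated_iff.1 <| associated_of_dvd_dvd
    (dvd_of_span_intCast_mul_eq hI hN.symm) (dvd_of_span_intCast_mul_eq hI hN)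
  -- If N(a) = -N(c), then ac' has norm -N(c)², which `hneg` forbids.
  have hnorm : norm a = norm c := by
    rcases hassoc with h1 | h1
    · exact h1.symm ▸ rfl
    · have := hneg (a * star c) (norm c) (by
        rw [map_mul, norm_star]
        have : norm a = - norm c := by rw [h1]; ring
        rw [this]; ring)
      exact absurd this (norm_ne_zero hc)
  have hac : a * star a = c * star c := by rw [mul_star_eq_norm, mul_star_eq_norm, hnorm]
  -- Hilbert 90 for a/c: the conjugate of 1 + a/c, cleared of denominators, serves unless a/c = -1,
  -- where √D does.
  obtain ⟨g, hg0, hg⟩ : ∃ g : QuadraticAlgebra ℤ m 1, g ≠ 0 ∧ c * star g = a * g := by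
    by_cases h0 : a + c = 0
    · refine ⟨sqrtDisc m, fun h0 => by simpa [sqrtDisc] using congrArg im h0, ?_⟩
      rw [star_sqrtDisc]
      linear_combination -sqrtDisc m * h0
    · refine ⟨star ((a + c) * star c), star_ne_zero.2 (mul_ne_zero h0 hsc), ?_⟩
      simp only [star_star, star_mul, star_add]
      linear_combination (-c) * hac
  refine ⟨g, hg0, fun x hx => ?_⟩
  have hst : conjIdeal (Ideal.span {g} * I) = Ideal.span {g} * I := by
    rw [conjIdeal_mul, conjIdeal_span_singleton]
    refine (Ideal.span_singleton_mul_right_inj (mul_ne_zero ha hc)).1 ?_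
    rw [← Ideal.span_singleton_mul_span_singleton, mul_assoc, ← mul_assoc (Ideal.span {c}),
      Ideal.span_singleton_mul_span_singleton c, hg, ← Ideal.span_singleton_mul_span_singleton,
      mul_left_comm, mul_assoc, mul_left_comm, ← h, mul_assoc (Ideal.span {a}), mul_left_comm (Ideal.span {c}),
      mul_left_comm]
  rw [← hst]
  exact star_mem_conjIdeal hx

/-- If `D = p * q`, `-1` is not a norm and some unit is not a square up to sign, then the ideal
classes cannot form a group of order two. -/
theorem not_forall_mul_principal [IsDomain (QuadraticAlgebra ℤ m 1)] {p q : ℕ}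
    (hp : p.Prime) (hq : q.Prime) (hne : p ≠ q) (h : (p * q : ℤ) = 4 * m + 1)
    (hneg : ∀ (x : QuadraticAlgebra ℤ m 1) (n : ℤ), norm x = -n ^ 2 → n = 0)
    {u : (QuadraticAlgebra ℤ m 1)ˣ}
    (hsq : ∀ v : (QuadraticAlgebra ℤ m 1)ˣ, u ≠ v ^ 2 ∧ u ≠ -v ^ 2)
    {I : Ideal (QuadraticAlgebra ℤ m 1)} (hI : ¬ ∃ x, I = Ideal.span {x})
    (hmul : ∀ I J : Ideal (QuadraticAlgebra ℤ m 1), (¬ ∃ x, I = Ideal.span {x}) →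
      (¬ ∃ x, J = Ideal.span {x}) → ∃ x, I * J = Ideal.span {x}) : False := by
  have hu : norm (u : QuadraticAlgebra ℤ m 1) = 1 :=
    (norm_units u).resolve_right fun h1 => by simpa using hneg u 1 (by simpa using h1)
  obtain ⟨h1, h2⟩ := exists_discIdeal_eq_span hp hq hne h hu hsq
  have hI0 : I ≠ ⊥ := fun h0 => hI ⟨0, by simp [h0]⟩
  have hsI : ¬ ∃ x, conjIdeal I = Ideal.span {x} := fun ⟨x, hx⟩ =>
    hI ⟨star x, by rw [← conjIdeal_span_singleton, ← hx, conjIdeal_conjIdeal]⟩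
  have hsI0 : conjIdeal I ≠ ⊥ := fun h0 => hsI ⟨0, by simp [h0]⟩
  obtain ⟨a, ha⟩ := hmul I I hI hI
  obtain ⟨c, hc⟩ := hmul I (conjIdeal I) hI hsI
  have ha0 : a ≠ 0 := by
    rintro rfl
    exact hI0 (by simpa using ha)
  have hc0 : c ≠ 0 := by
    rintro rfl
    rw [Ideal.span_singleton_eq_bot.2 rfl, Ideal.mul_eq_bot] at hc
    exact hc.elim hI0 hsI0
  -- The hypothesis holds because cI = (I·I')·I = (I·I)·I' = aI'.
  obtain ⟨g, hg0, hg⟩ := exists_star_mem_of_span_mul_eq hneg hI0 ha0 hc0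
    (by rw [← ha, ← hc, mul_right_comm, mul_assoc])
  obtain ⟨x, hx⟩ := exists_eq_span_of_star_mem hp hq h h1 h2 hg
  obtain ⟨y, hy⟩ : g ∣ x := Ideal.mem_span_singleton.1 <|
    Ideal.mul_le_left (J := I) (by rw [hx]; exact Ideal.mem_span_singleton_self _)
  rw [hy, ← Ideal.span_singleton_mul_span_singleton] at hx
  exact hI ⟨y, (Ideal.span_singleton_mul_right_inj hg0).1 hx⟩

/-! ### Units of norm -1 -/

/-- If `D` is a sum of two squares and `ℤ[ω]` is principal, then some unit has norm `-1`. -/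
theorem exists_unit_norm_eq_neg_one [IsDomain (QuadraticAlgebra ℤ m 1)]
    [IsPrincipalIdealRing (QuadraticAlgebra ℤ m 1)] {a b : ℤ} (hb : b ≠ 0)
    (h : a ^ 2 + b ^ 2 = 4 * m + 1) :
    ∃ u : (QuadraticAlgebra ℤ m 1)ˣ, norm (u : QuadraticAlgebra ℤ m 1) = -1 := by
  set x : QuadraticAlgebra ℤ m 1 := a + sqrtDisc m with hx
  have hbb : x * star x = -((b : QuadraticAlgebra ℤ m 1) * b) := by
    have h1 := congrArg (Int.cast : ℤ → QuadraticAlgebra ℤ m 1) h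
    rw [← sqrtDisc_mul_self] at h1
    push_cast at h1
    rw [hx, star_add, star_sqrtDisc, star_intCast_eq]
    linear_combination h1
  have hnx : norm x = -b ^ 2 := by
    rw [mul_star_eq_norm] at hbb
    have : ((norm x : ℤ) : QuadraticAlgebra ℤ m 1) = ((-b ^ 2 : ℤ) : QuadraticAlgebra ℤ m 1) := by
      rw [hbb]; push_cast; ring
    exact Int.cast_injective this
  have hb' : (b : QuadraticAlgebra ℤ m 1) ≠ 0 := Int.cast_ne_zero.2 hb
  obtain ⟨g, hg⟩ : ∃ g, Ideal.span {(b : QuadraticAlgebra ℤ m 1), x} = Ideal.span {g} :=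
    (IsPrincipalIdealRing.principal _).1
  have hg0 : g ≠ 0 := by
    rintro rfl
    have : (b : QuadraticAlgebra ℤ m 1) ∈ Ideal.span {(0 : QuadraticAlgebra ℤ m 1)} := by
      rw [← hg]; exact Ideal.subset_span (by simp)
    exact hb' (by simpa using this)
  -- x·(b, x') = (xb, -b²) = b·(b, x). Replacing the ideal by its generator g and taking norms
  -- forces a unit of norm -1.
  have hI : Ideal.span {x} * conjIdeal (Ideal.span {(b : QuadraticAlgebra ℤ m 1), x}) =
      Ideal.span {(b : QuadraticAlgebra ℤ m 1)} * Ideal.span {(b : QuadraticAlgebra ℤ m 1), x} := by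
    rw [conjIdeal, Ideal.map_span, Set.image_pair, starRingEnd_apply, starRingEnd_apply,
      star_intCast_eq, Ideal.span_insert, Ideal.span_insert, Ideal.mul_sup, Ideal.mul_sup]
    simp only [Ideal.span_singleton_mul_span_singleton]
    rw [hbb, Ideal.span_singleton_neg, sup_comm, mul_comm x]
  rw [hg, conjIdeal_span_singleton, Ideal.span_singleton_mul_span_singleton,
    Ideal.span_singleton_mul_span_singleton, Ideal.span_singleton_eq_span_singleton] at hI
  obtain ⟨u, hu⟩ := hI
  refine ⟨u, ?_⟩
  have hn := congrArg norm hu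
  simp only [map_mul, norm_star, norm_intCast, hnx] at hn
  have h0 : b ^ 2 * norm g ≠ 0 := mul_ne_zero (pow_ne_zero _ hb) (norm_ne_zero hg0)
  refine mul_left_cancel₀ h0 ?_
  linear_combination -hn

/-- The ω-coordinate of x² is im·(2re + im). If it vanishes, then x² is re² or D·re², and neither is
±p. -/
theorem sq_ne_prime {p q : ℕ} (hp : p.Prime) (hq : q.Prime) (h : (p * q : ℤ) = 4 * m + 1)
    (x : QuadraticAlgebra ℤ m 1) : x ^ 2 ≠ p ∧ x ^ 2 ≠ -p := by
  suffices ∀ n : ℤ, n.natAbs = p → x ^ 2 ≠ (n : QuadraticAlgebra ℤ m 1) by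
    refine ⟨?_, ?_⟩
    · simpa using this p (by simp)
    · simpa using this (-p) (by simp)
  rintro n hn hx
  rw [pow_two] at hx
  have him := congrArg im hx
  have hre := congrArg re hx
  simp only [im_mul, re_mul, re_intCast, im_intCast, Int.cast_id] at him hre
  have h0 : x.im * (2 * x.re + x.im) = 0 := by linear_combination him
  rcases mul_eq_zero.1 h0 with h1 | h1
  · rw [h1] at hre
    have : x.re.natAbs ^ 2 = p := by
      rw [← hn, ← hre, ← Int.natAbs_pow]; congr 1; ring
    exact hp.not_isSquare ⟨_, by rw [← this, pow_two]⟩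
  · have h2 : x.re ^ 2 * (p * q) = n := by
      rw [h, ← hre, eq_neg_of_add_eq_zero_right h1]; ring
    have h3 : (x.re.natAbs ^ 2 * q) * p = 1 * p := by
      have := congrArg Int.natAbs h2
      rw [Int.natAbs_mul, Int.natAbs_mul, Int.natAbs_pow, hn] at this
      simp only [Int.natAbs_natCast] at this
      linarith
    have h4 := Nat.eq_of_mul_eq_mul_right hp.pos h3
    exact hq.one_lt.ne' (Nat.eq_one_of_mul_eq_one_left h4)

/-- If `D = p * q` is a sum of two squares and the units are generated by `-1` and a single unit,
then `ℤ[ω]` is not principal. -/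
theorem not_isPrincipalIdealRing [IsDomain (QuadraticAlgebra ℤ m 1)] {p q : ℕ}
    (hp : p.Prime) (hq : q.Prime) (hne : p ≠ q) (h : (p * q : ℤ) = 4 * m + 1)
    {a b : ℤ} (hb : b ≠ 0) (hab : a ^ 2 + b ^ 2 = 4 * m + 1) {ε : (QuadraticAlgebra ℤ m 1)ˣ}
    (hε : ∀ u : (QuadraticAlgebra ℤ m 1)ˣ, ∃ n : ℤ, u = ε ^ n ∨ u = -ε ^ n) :
    ¬ IsPrincipalIdealRing (QuadraticAlgebra ℤ m 1) := by
  intro _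
  have hc : IsCoprime (p : ℤ) q := Nat.isCoprime_iff_coprime.2 ((Nat.coprime_primes hp hq).2 hne)
  let N : (QuadraticAlgebra ℤ m 1)ˣ →* ℤˣ := Units.map norm
  have hN : ∀ u, ((N u : ℤˣ) : ℤ) = norm (u : QuadraticAlgebra ℤ m 1) := fun u => rfl
  have hNneg : ∀ u, N (-u) = N u := fun u => Units.ext (by simp [hN])
  obtain ⟨η, hη⟩ := exists_unit_norm_eq_neg_one hb hab
  -- Otherwise all units would have norm 1, including η.
  have hNε : N ε = -1 := by
    refine (Int.units_eq_one_or (N ε)).resolve_left fun h1 => ?_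
    have : N η = 1 := by
      obtain ⟨n, hn | hn⟩ := hε η
      · rw [hn, map_zpow, h1, one_zpow]
      · rw [hn, hNneg, map_zpow, h1, one_zpow]
    rw [← hN, this] at hη
    norm_num at hη
  have hsq : ∀ u, N u = 1 → ∃ v, u = v ^ 2 ∨ u = -v ^ 2 := fun u hu => by
    obtain ⟨n, hn⟩ := hε u
    have h1 : (-1 : ℤˣ) ^ n = 1 := by
      rw [← hNε, ← map_zpow, ← hu]
      rcases hn with rfl | rfl
      · rfl
      · rw [hNneg]
    have heven : Even n := by
      by_contra ho
      rw [Int.not_even_iff_odd] at ho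
      rw [ho.neg_one_zpow] at h1
      exact absurd h1 (by decide)
    obtain ⟨k, rfl⟩ := heven
    exact ⟨ε ^ k, by rwa [pow_two, ← zpow_add]⟩
  obtain ⟨g, hg⟩ : ∃ g, discIdeal m p = Ideal.span {g} := (IsPrincipalIdealRing.principal _).1
  have hgp := discIdeal_mul_self h hc
  rw [hg, Ideal.span_singleton_mul_span_singleton, Ideal.span_singleton_eq_span_singleton] at hgp
  obtain ⟨u, hu⟩ := hgp
  -- Taking norms in g²u = p gives N(g)²N(u) = p² > 0.
  have hNu : N u = 1 := by
    have h1 := congrArg norm hu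
    rw [map_mul, map_mul, ← hN, norm_intCast] at h1
    refine (Int.units_eq_one_or (N u)).resolve_right fun h2 => ?_
    rw [h2] at h1
    have hp0 : (0 : ℤ) < p := by exact_mod_cast hp.pos
    push_cast at h1
    nlinarith [mul_self_nonneg (norm g)]
  obtain ⟨v, hv⟩ := hsq u hNu
  push_cast at hu
  rcases hv with rfl | rfl
  · exact (sq_ne_prime hp hq h (g * v)).1 (by rw [← hu]; push_cast; ring)
  · exact (sq_ne_prime hp hq h (g * v)).2 (by rw [← hu]; push_cast; ring)

end QuadraticAlgebra

/-! ### Discriminant and ring of integers of a quadratic field -/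

namespace QuadraticAlgebra

theorem algebraTrace_eq {R : Type*} [CommRing R] {a b : R} (z : QuadraticAlgebra R a b) :
    Algebra.trace R (QuadraticAlgebra R a b) z = 2 * z.re + b * z.im := by
  rw [Algebra.trace_eq_matrix_trace (basis a b), Matrix.trace_fin_two,
    Algebra.leftMulMatrix_eq_repr_mul, Algebra.leftMulMatrix_eq_repr_mul]
  have h0 : basis a b 0 = 1 := (basis a b).repr.injective <| by
    ext i; fin_cases i <;> simp
  have h1 : basis a b 1 = ω := (basis a b).repr.injective <| by
    ext i; fin_cases i <;> simp
  rw [h0, h1]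
  simp
  ring

theorem algebraDiscr_basis {R : Type*} [CommRing R] {a b : R} :
    Algebra.discr R (basis a b) = 4 * a + b ^ 2 := by
  have h0 : basis a b 0 = 1 := (basis a b).repr.injective <| by
    ext i; fin_cases i <;> simp
  have h1 : basis a b 1 = ω := (basis a b).repr.injective <| by
    ext i; fin_cases i <;> simp
  rw [Algebra.discr_def, Matrix.det_fin_two]
  simp only [Algebra.traceMatrix_apply, Algebra.traceForm_apply, algebraTrace_eq, h0, h1]
  simp
  ring

theorem discr_eq_of_algEquiv {K : Type*} [Field K] [NumberField K] {t u : ℤ}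
    (e : QuadraticAlgebra ℤ t u ≃ₐ[ℤ] 𝓞 K) : NumberField.discr K = 4 * t + u ^ 2 := by
  rw [← NumberField.discr_eq_discr K ((basis t u).map e.toLinearEquiv), ← algebraDiscr_basis,
    Algebra.discr_eq_discr_of_algEquiv _ e]
  rfl

/-- An integral element of `ℚ(√d)` has the form `(a + b√d) / 2` with `4 ∣ a ^ 2 - d * b ^ 2`. -/
theorem exists_eq_half_of_isIntegral {d : ℤ} (hd : Squarefree d) {w : QuadraticAlgebra ℚ d 0}
    (hw : IsIntegral ℤ w) :
    ∃ a b : ℤ, w = ⟨a / 2, b / 2⟩ ∧ 4 ∣ a ^ 2 - d * b ^ 2 := by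
  have hsw : IsIntegral ℤ (star w) :=
    hw.map (starRingEnd (QuadraticAlgebra ℚ d 0)).toIntAlgHom
  have hinj : Function.Injective (algebraMap ℚ (QuadraticAlgebra ℚ d 0)) := algebraMap_injective
  have htr : IsIntegral ℤ (2 * w.re) := by
    rw [← isIntegral_algebraMap_iff hinj]
    convert hw.add hsw using 1
    ext <;> simp; ring
  have hn : IsIntegral ℤ (norm w) := by
    rw [← isIntegral_algebraMap_iff hinj, algebraMap_norm_eq_mul_star]
    exact hw.mul hsw
  obtain ⟨a, ha⟩ := IsIntegrallyClosed.isIntegral_iff.1 htr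
  obtain ⟨n, hn⟩ := IsIntegrallyClosed.isIntegral_iff.1 hn
  simp only [algebraMap_int_eq, eq_intCast] at ha hn
  rw [norm_def] at hn
  set r : ℚ := 2 * w.im with hr
  have hk : (d : ℚ) * r ^ 2 = ((a ^ 2 - 4 * n : ℤ) : ℚ) := by
    push_cast
    rw [ha, hn, hr]; ring
  -- Since d·r² is an integer and r is in lowest terms, the square of its denominator divides d.
  have hden : IsUnit (r.den : ℤ) := by
    apply hd
    have h1 : d * r.num ^ 2 = (a ^ 2 - 4 * n) * (r.den * r.den) := by
      have h2 : (d : ℚ) * r.num ^ 2 = ((a ^ 2 - 4 * n : ℤ) : ℚ) * (r.den * r.den) := by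
        rw [← hk, ← Rat.mul_den_eq_num]; ring
      exact_mod_cast h2
    have hc : IsCoprime ((r.den : ℤ) * r.den) (r.num ^ 2) := by
      have : IsCoprime (r.num : ℤ) r.den := by
        rw [Int.isCoprime_iff_nat_coprime]; simpa using r.reduced
      rw [← pow_two]
      exact this.symm.pow
    exact hc.dvd_of_dvd_mul_right ⟨_, h1.trans (mul_comm _ _)⟩
  have hb : r = r.num := by
    have : r.den = 1 := by simpa [Int.isUnit_iff_natAbs_eq] using hden
    exact (Rat.coe_int_num_of_den_eq_one this).symm
  refine ⟨a, r.num, ?_, n, ?_⟩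
  · ext
    · simp [ha]
    · change w.im = (r.num : ℚ) / 2
      rw [← hb, hr]; ring
  · rw [hb] at hk
    have : d * r.num ^ 2 = a ^ 2 - 4 * n := by exact_mod_cast hk
    linarith

theorem isIntegral_of_mul_self_eq {A : Type*} [CommRing A] {x : A} {t u : ℤ}
    (hx : x * x = t + u * x) : IsIntegral ℤ x := by
  refine ⟨Polynomial.X ^ (1 + 1) - (Polynomial.C u * Polynomial.X + Polynomial.C t),
    Polynomial.monic_X_pow_sub (Polynomial.degree_linear_le.trans_lt (by norm_num)), ?_⟩
  simp only [Polynomial.eval₂_sub, Polynomial.eval₂_add, Polynomial.eval₂_mul, Polynomial.eval₂_pow,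
    Polynomial.eval₂_X, Polynomial.eval₂_C, algebraMap_int_eq]
  simp only [eq_intCast]
  linear_combination hx

/-- Treats the generators (1 + √d)/2 and √d together. Injectivity holds because x is not rational;
`hspan` gives surjectivity, integers being of the form (a + b√d)/2 with 4 ∣ a² - db². -/
theorem exists_algEquiv_ringOfIntegers {K : Type*} [Field K] [NumberField K] {d : ℤ}
    (hd : Squarefree d) (F : QuadraticAlgebra ℚ d 0 ≃ₐ[ℚ] K) {t u : ℤ}
    {x : QuadraticAlgebra ℚ d 0} (hx : x * x = t + u * x) (him : x.im ≠ 0)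
    (hspan : ∀ a b : ℤ, 4 ∣ a ^ 2 - d * b ^ 2 →
      ∃ r s : ℤ, (⟨a / 2, b / 2⟩ : QuadraticAlgebra ℚ d 0) = r + s * x) :
    Nonempty (QuadraticAlgebra ℤ t u ≃ₐ[ℤ] 𝓞 K) := by
  have hFx : F x * F x = t + u * F x := by rw [← map_mul, hx]; simp
  let θ : 𝓞 K := ⟨F x, isIntegral_of_mul_self_eq hFx⟩
  have hθ : θ * θ = t • 1 + u • θ := by
    apply NumberField.RingOfIntegers.ext
    simp only [zsmul_eq_mul, mul_one, map_mul, map_add, map_intCast]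
    exact hFx
  let g : QuadraticAlgebra ℤ t u →ₐ[ℤ] 𝓞 K := lift ⟨θ, hθ⟩
  have hg : ∀ z, ((g z : 𝓞 K) : K) = F (z.re + z.im * x) := fun z => by
    have : g z = z.re • 1 + z.im • θ := rfl
    rw [this]
    simp only [zsmul_eq_mul, mul_one, map_mul, map_add, map_intCast]
    rfl
  refine ⟨AlgEquiv.ofBijective g ⟨?_, fun z => ?_⟩⟩
  · refine (injective_iff_map_eq_zero g).2 fun z hz => ?_
    have h1 : F (z.re + z.im * x) = 0 := by rw [← hg, hz]; rfl
    rw [map_eq_zero_iff F F.injective] at h1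
    have h2 : z.im = 0 := by
      have := congrArg im h1
      simpa [him] using this
    have h3 : z.re = 0 := by
      have := congrArg re h1
      simpa [h2] using this
    ext
    · exact h3
    · exact h2
  · have hint : IsIntegral ℤ (F.symm z) :=
      z.isIntegral_coe.map ((F.symm : K →+* QuadraticAlgebra ℚ d 0).toIntAlgHom)
    obtain ⟨a, b, hab, h4⟩ := exists_eq_half_of_isIntegral hd hint
    obtain ⟨r, s, hrs⟩ := hspan a b h4
    refine ⟨⟨r, s⟩, NumberField.RingOfIntegers.ext ?_⟩
    rw [hg, ← hrs, ← hab]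
    simp

theorem exists_algEquiv_of_eq_four_mul_add_one {K : Type*} [Field K] [NumberField K] {d m : ℤ}
    (hd : Squarefree d) (F : QuadraticAlgebra ℚ d 0 ≃ₐ[ℚ] K) (hm : d = 4 * m + 1) :
    Nonempty (QuadraticAlgebra ℤ m 1 ≃ₐ[ℤ] 𝓞 K) := by
  refine exists_algEquiv_ringOfIntegers hd F (x := ⟨1 / 2, 1 / 2⟩) ?_ (by norm_num) ?_
  · ext <;> simp [hm] <;> ring
  · intro a b h
    -- As d is odd, a² - db² being even forces a ≡ b mod 2.
    have hab : Even (a - b) := by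
      have : (2 : ℤ) ∣ a ^ 2 - d * b ^ 2 := Dvd.dvd.trans (by norm_num) h
      rw [← even_iff_two_dvd, hm] at this
      have hodd : ¬ Even (4 * m + 1) := Int.not_even_iff_odd.2 ⟨2 * m, by ring⟩
      rw [Int.even_sub, Int.even_mul, Int.even_pow' two_ne_zero, Int.even_pow' two_ne_zero] at this
      rw [Int.even_sub]
      tauto
    obtain ⟨c, hc⟩ := hab
    refine ⟨c, b, ?_⟩
    have hc' : (a : ℚ) = b + (c + c) := by exact_mod_cast (sub_eq_iff_eq_add'.1 hc)
    ext
    · simp [hc']; ring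
    · simp; ring

theorem exists_algEquiv_of_emod_four_ne_one {K : Type*} [Field K] [NumberField K] {d : ℤ}
    (hd : Squarefree d) (F : QuadraticAlgebra ℚ d 0 ≃ₐ[ℚ] K) (hm : d % 4 ≠ 1) :
    Nonempty (QuadraticAlgebra ℤ d 0 ≃ₐ[ℤ] 𝓞 K) := by
  refine exists_algEquiv_ringOfIntegers hd F (x := ⟨0, 1⟩) ?_ (by norm_num) ?_
  · ext <;> simp
  · intro a b h
    have h0 : ¬ (2 * 2 ∣ d) := fun h2 => by
      have := Int.isUnit_iff.1 (hd 2 h2)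
      omega
    -- Squares are 0 or 1 mod 4 and d is 2 or 3 mod 4, so a² ≡ db² leaves only even a and b.
    have hab : 2 ∣ a ∧ 2 ∣ b := by
      have h5 : (a ^ 2 - d * b ^ 2) % 4 = 0 := Int.emod_eq_zero_of_dvd h
      rw [Int.sub_emod, Int.mul_emod, pow_two, pow_two, Int.mul_emod a, Int.mul_emod b] at h5
      have ha : a % 4 = 0 ∨ a % 4 = 1 ∨ a % 4 = 2 ∨ a % 4 = 3 := by omega
      have hb : b % 4 = 0 ∨ b % 4 = 1 ∨ b % 4 = 2 ∨ b % 4 = 3 := by omega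
      have hd' : d % 4 = 2 ∨ d % 4 = 3 := by omega
      rcases ha with ha | ha | ha | ha <;> rcases hb with hb | hb | hb | hb <;>
        rcases hd' with hd' | hd' <;> rw [ha, hb, hd'] at h5 <;> norm_num at h5 <;> omega
    obtain ⟨⟨r, rfl⟩, ⟨s, rfl⟩⟩ := hab
    refine ⟨r, s, ?_⟩
    ext <;> simp

end QuadraticAlgebra

open QuadraticAlgebra

theorem exists_algEquiv_quadField {d : ℤ} (hd : ¬ IsSquare d) :
    Nonempty (QuadraticAlgebra ℚ d 0 ≃ₐ[ℚ] quadField d) := by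
  -- Having no rational square root of d makes `QuadraticAlgebra ℚ d 0` a field.
  have : Fact (∀ r : ℚ, r ^ 2 ≠ d + 0 * r) := ⟨fun r hr => hd <| by
    rw [zero_mul, add_zero] at hr
    exact Rat.isSquare_intCast_iff.1 ⟨r, by rw [← hr, pow_two]⟩⟩
  obtain ⟨s, hs⟩ := IsAlgClosed.exists_eq_mul_self (d : ℂ)
  let f : QuadraticAlgebra ℚ d 0 →ₐ[ℚ] ℂ := lift ⟨s, by simp [← hs, Algebra.smul_def]⟩
  have hf : ∀ z, f z = z.re + z.im * s := fun z => by
    have : f z = z.re • 1 + z.im • s := rfl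
    rw [this]; simp [Algebra.smul_def]
  have hr : f.fieldRange = quadField d := by
    apply le_antisymm
    · rintro _ ⟨z, rfl⟩
      change f z ∈ quadField d
      have hsm : s ∈ quadField d := IntermediateField.subset_adjoin ℚ _ (by
        simp [hs, pow_two])
      rw [hf]
      exact add_mem ((quadField d).algebraMap_mem _)
        (mul_mem ((quadField d).algebraMap_mem _) hsm)
    · refine IntermediateField.adjoin_le_iff.2 fun z hz => ?_
      have hz' : z ^ 2 = s ^ 2 := by rw [pow_two s, ← hs]; exact hz
      rcases sq_eq_sq_iff_eq_or_eq_neg.1 hz' with rfl | rfl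
      · exact ⟨ω, by simp [hf]⟩
      · exact ⟨-ω, by simp [hf]⟩
  exact ⟨(AlgEquiv.ofInjectiveField f).trans (IntermediateField.equivOfEq hr)⟩

/-! ### Units of a real quadratic field -/

open QuadraticAlgebra

/-- An embedding sends √d to a complex square root of d > 0, which is real. -/
theorem isTotallyReal_of_algEquiv {K : Type*} [Field K] [NumberField K] {d : ℤ} (hd : 0 < d)
    (F : QuadraticAlgebra ℚ d 0 ≃ₐ[ℚ] K) : NumberField.IsTotallyReal K := by
  rw [NumberField.isTotallyReal_iff]
  intro v
  rw [NumberField.InfinitePlace.isReal_iff, NumberField.ComplexEmbedding.isReal_iff]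
  ext z
  set φ := v.embedding
  obtain ⟨w, rfl⟩ := F.surjective z
  have hω : φ (F ω) ^ 2 = ((Real.sqrt d : ℝ) : ℂ) ^ 2 := by
    rw [← map_pow, ← map_pow, pow_two, omega_mul_omega_eq_add, ← Complex.ofReal_pow,
      Real.sq_sqrt (by exact_mod_cast hd.le)]
    simp
  obtain ⟨r, hr⟩ : ∃ r : ℝ, φ (F ω) = r := by
    rcases sq_eq_sq_iff_eq_or_eq_neg.1 hω with h | h
    · exact ⟨_, h⟩
    · exact ⟨-Real.sqrt d, by rw [h]; simp⟩
  have hw : φ (F w) = w.re + w.im * φ (F ω) := by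
    have : w = w.re • 1 + w.im • ω := by ext <;> simp
    conv_lhs => rw [this]
    simp [Algebra.smul_def]
  rw [NumberField.ComplexEmbedding.conjugate_coe_eq, hw, hr]
  simp

/-- The unit group of a real quadratic field is generated by `-1` and a unit of infinite order. -/
theorem exists_fundamental_unit {K : Type*} [Field K] [NumberField K] [NumberField.IsTotallyReal K]
    (h2 : Module.finrank ℚ K = 2) :
    ∃ ε : (𝓞 K)ˣ, (∀ u, ∃ n : ℤ, u = ε ^ n ∨ u = -ε ^ n) ∧ ∀ n : ℤ, ε ^ n = 1 → n = 0 := by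
  have hrank : NumberField.Units.rank K = 1 := by
    rw [NumberField.Units.rank, NumberField.InfinitePlace.card_eq_nrRealPlaces_add_nrComplexPlaces,
      NumberField.IsTotallyReal.nrComplexPlaces_eq_zero, ← NumberField.IsTotallyReal.finrank, h2]
  let i : Fin (NumberField.Units.rank K) := ⟨0, by omega⟩
  have : Subsingleton (Fin (NumberField.Units.rank K)) := by rw [hrank]; infer_instance
  -- A root of unity has absolute value 1 under a real embedding, so its image is ±1.
  have htors : ∀ ζ ∈ NumberField.Units.torsion K, ζ = 1 ∨ ζ = -1 := fun ζ hζ => by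
    obtain ⟨w⟩ : Nonempty (NumberField.InfinitePlace K) := inferInstance
    have hw := NumberField.IsTotallyReal.isReal w
    have h1 := (NumberField.Units.mem_torsion K).1 hζ w
    rw [← NumberField.InfinitePlace.norm_embedding_of_isReal hw, Real.norm_eq_abs] at h1
    have hinj : ∀ y : (𝓞 K)ˣ, NumberField.InfinitePlace.embedding_of_isReal hw (ζ : K) =
        NumberField.InfinitePlace.embedding_of_isReal hw (y : K) → ζ = y := fun y hy =>
      Units.ext (NumberField.RingOfIntegers.ext (RingHom.injective _ hy))
    rcases abs_eq (zero_le_one) |>.1 h1 with h | h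
    · exact .inl (hinj 1 (by rw [h]; simp))
    · exact .inr (hinj (-1) (by rw [h]; simp))
  refine ⟨NumberField.Units.fundSystem K i, fun u => ?_, fun n hn => ?_⟩
  · obtain ⟨⟨ζ, f⟩, h, -⟩ := NumberField.Units.exist_unique_eq_mul_prod K u
    rw [Fintype.prod_subsingleton _ i] at h
    refine ⟨f i, ?_⟩
    rcases htors ζ ζ.2 with hζ | hζ
    · left; rw [h]; simp [hζ]
    · right; rw [h]; simp [hζ]
  · have h1 := NumberField.Units.fun_eq_repr K (x := 1) (ζ := 1) (f := fun _ => n)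
      (one_mem _) (by rw [Fintype.prod_subsingleton _ i, hn, one_mul])
    have h2 := NumberField.Units.fun_eq_repr K (x := 1) (ζ := 1) (f := fun _ => 0)
      (one_mem _) (by simp)
    exact congrFun (h1.trans h2.symm) i

/-- Any v is ±ε^k. Squaring ε = ±v² removes the sign and gives ε^(4k - 2) = 1, though 4k - 2 ≠ 0. -/
theorem exists_fundamental_unit_of_ringEquiv {K : Type*} [Field K] [NumberField K]
    [NumberField.IsTotallyReal K] (h2 : Module.finrank ℚ K = 2) {A : Type*} [CommRing A]
    (e : A ≃+* 𝓞 K) :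
    ∃ ε : Aˣ, (∀ u, ∃ n : ℤ, u = ε ^ n ∨ u = -ε ^ n) ∧ ∀ v, ε ≠ v ^ 2 ∧ ε ≠ -v ^ 2 := by
  obtain ⟨ε, hε, hinf⟩ := exists_fundamental_unit h2
  let E : Aˣ ≃* (𝓞 K)ˣ := Units.mapEquiv e.toMulEquiv
  have hneg : ∀ u, E.symm (-u) = -E.symm u := fun u => Units.ext (map_neg e.symm (u : 𝓞 K))
  have hgen : ∀ u : Aˣ, ∃ n : ℤ, u = E.symm ε ^ n ∨ u = -E.symm ε ^ n := fun u => by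
    obtain ⟨n, h | h⟩ := hε (E u)
    · exact ⟨n, .inl (by rw [← map_zpow, ← h, E.symm_apply_apply])⟩
    · exact ⟨n, .inr (by rw [← map_zpow, ← hneg, ← h, E.symm_apply_apply])⟩
  have hinf' : ∀ n : ℤ, E.symm ε ^ n = 1 → n = 0 := fun n hn =>
    hinf n (E.symm.injective (by rw [map_zpow, hn, map_one]))
  refine ⟨E.symm ε, hgen, fun v => ?_⟩
  generalize E.symm ε = η at *
  have key : ∀ k : ℤ, (η ^ k) ^ 2 ≠ η ∧ (η ^ k) ^ 2 ≠ -η := fun k => by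
    have hz : η ^ (4 * k - 2) ≠ 1 := fun h => by have := hinf' _ h; omega
    have h4 : η ^ (4 * k - 2) * η ^ 2 = ((η ^ k) ^ 2) ^ 2 := by
      rw [← zpow_natCast, ← zpow_natCast, ← zpow_natCast, ← zpow_mul, ← zpow_mul, ← zpow_add]
      congr 1; push_cast; ring
    refine ⟨fun h => hz ?_, fun h => hz ?_⟩ <;> rw [h] at h4
    · exact mul_eq_right.1 h4
    · rw [neg_sq] at h4; exact mul_eq_right.1 h4
  obtain ⟨k, h | h⟩ := hgen v
  · rw [h]
    exact ⟨fun h1 => (key k).1 h1.symm, fun h1 => (key k).2 (neg_eq_iff_eq_neg.2 h1).symm⟩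
  · rw [h, neg_sq]
    exact ⟨fun h1 => (key k).1 h1.symm, fun h1 => (key k).2 (neg_eq_iff_eq_neg.2 h1).symm⟩

/-! ### Class groups of order two -/

/-- The only nontrivial class is its own inverse. Phrased through ideals alone, this passes along
ring isomorphisms. -/
theorem exists_not_principal_of_card_classGroup_eq_two {R : Type*} [CommRing R] [IsDedekindDomain R]
    [Fintype (ClassGroup R)] (h : Fintype.card (ClassGroup R) = 2) :
    (∃ I : Ideal R, ¬ ∃ x, I = Ideal.span {x}) ∧
      ∀ I J : Ideal R, (¬ ∃ x, I = Ideal.span {x}) → (¬ ∃ x, J = Ideal.span {x}) →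
        ∃ x, I * J = Ideal.span {x} := by
  rw [← Nat.card_eq_fintype_card, Nat.card_eq_two_iff' (1 : ClassGroup R)] at h
  obtain ⟨c, hc, huniq⟩ := h
  have hI0 : ∀ I : Ideal R, (¬ ∃ x, I = Ideal.span {x}) → I ∈ nonZeroDivisors (Ideal R) :=
    fun I hI => mem_nonZeroDivisors_iff_ne_zero.2 fun h0 => hI ⟨0, by simp [h0]⟩
  have hone : ∀ (I : Ideal R) (h0 : I ∈ nonZeroDivisors (Ideal R)),
      ClassGroup.mk0 ⟨I, h0⟩ = 1 ↔ ∃ x, I = Ideal.span {x} := fun I h0 => by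
    rw [ClassGroup.mk0_eq_one_iff]
    exact ⟨fun h => h.1, fun h => ⟨h⟩⟩
  refine ⟨?_, fun I J hI hJ => ?_⟩
  · obtain ⟨⟨I, h0⟩, rfl⟩ := ClassGroup.mk0_surjective c
    exact ⟨I, fun h => hc ((hone I h0).2 h)⟩
  · have h1 := huniq _ fun h => hI ((hone I (hI0 I hI)).1 h)
    have h2 := huniq _ fun h => hJ ((hone J (hI0 J hJ)).1 h)
    have h3 := huniq c⁻¹ (inv_ne_one.2 hc)
    refine (hone (I * J) (mul_mem (hI0 I hI) (hI0 J hJ))).1 ?_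
    have : ClassGroup.mk0 ⟨I * J, mul_mem (hI0 I hI) (hI0 J hJ)⟩ =
        ClassGroup.mk0 ⟨I, hI0 I hI⟩ * ClassGroup.mk0 ⟨J, hI0 J hJ⟩ := by
      rw [← map_mul]; rfl
    rw [this, h1, h2]
    nth_rewrite 1 [← h3]
    exact inv_mul_cancel c

theorem exists_eq_span_of_map_ringEquiv {R A : Type*} [CommRing R] [CommRing A] (e : A ≃+* R)
    {I : Ideal A} (h : ∃ x, I.map (e : A →+* R) = Ideal.span {x}) : ∃ x, I = Ideal.span {x} := by
  obtain ⟨x, hx⟩ := h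
  refine ⟨e.symm x, ?_⟩
  rw [← Ideal.map_of_equiv e (I := I), hx, Ideal.map_span, Set.image_singleton]
  rfl

theorem exists_not_principal_of_ringEquiv {R A : Type*} [CommRing R] [CommRing A] (e : A ≃+* R)
    (h : (∃ I : Ideal R, ¬ ∃ x, I = Ideal.span {x}) ∧
      ∀ I J : Ideal R, (¬ ∃ x, I = Ideal.span {x}) → (¬ ∃ x, J = Ideal.span {x}) →
        ∃ x, I * J = Ideal.span {x}) :
    (∃ I : Ideal A, ¬ ∃ x, I = Ideal.span {x}) ∧
      ∀ I J : Ideal A, (¬ ∃ x, I = Ideal.span {x}) → (¬ ∃ x, J = Ideal.span {x}) →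
        ∃ x, I * J = Ideal.span {x} := by
  obtain ⟨⟨I, hI⟩, hmul⟩ := h
  refine ⟨⟨I.map (e.symm : R →+* A), fun hx => hI (exists_eq_span_of_map_ringEquiv e.symm hx)⟩,
    fun I J hI hJ => exists_eq_span_of_map_ringEquiv e ?_⟩
  rw [Ideal.map_mul]
  exact hmul _ _ (fun hx => hI (exists_eq_span_of_map_ringEquiv e hx))
    (fun hx => hJ (exists_eq_span_of_map_ringEquiv e hx))

/-! ### Sums of two squares and ramified primes -/

/-- Four times the equation reads (2re + im)² + (2n)² = pq·im². If im ≠ 0, the right side has odd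
p-adic valuation, impossible for a sum of two squares as p ≡ 3 mod 4. -/
theorem eq_zero_of_norm_eq_neg_sq {m : ℤ} {p q : ℕ} (hp : p.Prime) (hq : q.Prime) (hne : p ≠ q)
    (h : (p * q : ℤ) = 4 * m + 1) (hp3 : p % 4 = 3) (x : QuadraticAlgebra ℤ m 1) (n : ℤ)
    (hx : norm x = -n ^ 2) : n = 0 := by
  rw [norm_def] at hx
  have h1 : (2 * x.re + x.im) ^ 2 + (2 * n) ^ 2 = p * q * x.im ^ 2 := by
    rw [h]; linear_combination 4 * hx
  by_cases him : x.im = 0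
  · rw [him] at h1
    nlinarith [sq_nonneg n, sq_nonneg (2 * x.re + 0)]
  · exfalso
    have h2 : p * q * x.im.natAbs ^ 2 = (2 * x.re + x.im).natAbs ^ 2 + (2 * n).natAbs ^ 2 := by
      zify
      simp only [sq_abs]
      exact h1.symm
    have him' : x.im.natAbs ≠ 0 := by simpa using him
    have hfact : Fact p.Prime := ⟨hp⟩
    have h3 := Nat.eq_sq_add_sq_iff.1 ⟨_, _, h2⟩ p
      (Nat.mem_primeFactors.2 ⟨hp, by rw [mul_assoc]; exact dvd_mul_right _ _,
        mul_ne_zero (mul_ne_zero hp.ne_zero hq.ne_zero) (pow_ne_zero _ him')⟩) hp3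
    rw [padicValNat.mul (mul_ne_zero hp.ne_zero hq.ne_zero) (pow_ne_zero _ him'),
      padicValNat.mul hp.ne_zero hq.ne_zero, padicValNat.self hp.one_lt,
      padicValNat.pow, padicValNat.eq_zero_of_not_dvd
        (fun hd => hne ((Nat.prime_dvd_prime_iff_eq hp hq).1 hd))] at h3
    rw [add_zero, Nat.even_add, Nat.even_mul] at h3
    simp at h3

theorem mem_ramifiedPrimes_iff {K : Type*} [Field K] [NumberField K] {p : ℕ} :
    p ∈ ramifiedPrimes K ↔ p.Prime ∧ (p : ℤ) ∣ NumberField.discr K := by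
  refine and_congr_right fun hp => ?_
  rw [← NumberField.not_dvd_discr_iff_isUnramifiedIn K (𝓞 K) (Nat.prime_iff_prime_int.1 hp),
    not_not]

theorem not_isSquare_of_squarefree {d : ℤ} (hd : Squarefree d) (hd1 : 1 < d) : ¬ IsSquare d := by
  rintro ⟨r, rfl⟩
  rcases Int.isUnit_iff.1 (hd r dvd_rfl) with rfl | rfl <;> norm_num at hd1

/-- If exactly two primes ramify in `ℚ(√d)` and both are odd, then `d ≡ 1 mod 4` is their
product. -/
theorem exists_eq_mul_of_ramifiedPrimes {d : ℤ} (hd : Squarefree d) (hd1 : 1 < d)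
    (F : QuadraticAlgebra ℚ d 0 ≃ₐ[ℚ] quadField d)
    (hn : (ramifiedPrimes (quadField d)).ncard = 2) {p : ℕ}
    (hp : IsLeast (ramifiedPrimes (quadField d)) p) (hodd : p % 2 = 1) :
    ∃ (q : ℕ) (m : ℤ), p.Prime ∧ q.Prime ∧ p ≠ q ∧ d = 4 * m + 1 ∧ (p * q : ℤ) = 4 * m + 1 := by
  have h2 : 2 ∉ ramifiedPrimes (quadField d) := fun h => by
    have h1 := hp.2 h
    have h3 := (mem_ramifiedPrimes_iff.1 hp.1).1.two_le
    omega
  -- Otherwise the discriminant is 4d and 2 ramifies.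
  have hd4 : d % 4 = 1 := by
    by_contra hd4
    obtain ⟨e⟩ := exists_algEquiv_of_emod_four_ne_one hd F hd4
    refine h2 (mem_ramifiedPrimes_iff.2 ⟨Nat.prime_two, ?_⟩)
    rw [discr_eq_of_algEquiv e]
    exact ⟨2 * d, by push_cast; ring⟩
  obtain ⟨m, hm⟩ : ∃ m, d = 4 * m + 1 := ⟨d / 4, by omega⟩
  obtain ⟨e⟩ := exists_algEquiv_of_eq_four_mul_add_one hd F hm
  have hdisc : NumberField.discr (quadField d) = d := by
    rw [discr_eq_of_algEquiv e, hm]; ring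
  have hset : ramifiedPrimes (quadField d) = (d.natAbs.primeFactors : Set ℕ) := by
    ext r
    rw [mem_ramifiedPrimes_iff, hdisc, Finset.mem_coe, Nat.mem_primeFactors, Int.natCast_dvd]
    have : d.natAbs ≠ 0 := by omega
    tauto
  have hcard : d.natAbs.primeFactors.card = 2 := by
    rw [← Set.ncard_coe_finset, ← hset, hn]
  have hpm : p ∈ d.natAbs.primeFactors := by
    rw [← Finset.mem_coe, ← hset]; exact hp.1
  obtain ⟨q, hq⟩ := Finset.card_eq_one.1 (by rw [Finset.card_erase_of_mem hpm, hcard] :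
    (d.natAbs.primeFactors.erase p).card = 1)
  have hqm : q ∈ d.natAbs.primeFactors.erase p := by rw [hq]; exact Finset.mem_singleton_self q
  have hprod := Nat.prod_primeFactors_of_squarefree (Int.squarefree_natAbs.2 hd)
  rw [← Finset.mul_prod_erase _ _ hpm, hq, Finset.prod_singleton] at hprod
  refine ⟨q, m, Nat.prime_of_mem_primeFactors hpm,
    Nat.prime_of_mem_primeFactors (Finset.mem_of_mem_erase hqm),
    (Finset.ne_of_mem_erase hqm).symm, hm, ?_⟩
  rw [← hm, ← Nat.cast_mul, hprod]
  omega

theorem exists_sq_add_sq_eq_mul {p q : ℕ} (hp : p.Prime) (hq : q.Prime) (hne : p ≠ q)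
    (hp4 : p % 4 = 1) (hq4 : q % 4 = 1) : ∃ a b : ℤ, b ≠ 0 ∧ a ^ 2 + b ^ 2 = p * q := by
  have := Fact.mk hp
  have := Fact.mk hq
  obtain ⟨a, b, h⟩ := Nat.Prime.sq_add_sq (p := p) (by omega)
  obtain ⟨c, e, h'⟩ := Nat.Prime.sq_add_sq (p := q) (by omega)
  obtain ⟨x, y, hxy⟩ := Nat.sq_add_sq_mul h.symm h'.symm
  refine ⟨x, y, ?_, by exact_mod_cast hxy.symm⟩
  -- A vanishing y would make pq a square.
  rintro h0
  have hy : y = 0 := by exact_mod_cast h0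
  rw [hy, pow_two 0, mul_zero, add_zero] at hxy
  have hpx : p ∣ x := hp.dvd_of_dvd_pow (hxy ▸ dvd_mul_right p q)
  have : p * p ∣ p * q := by rw [hxy, pow_two]; exact mul_dvd_mul hpx hpx
  exact hne ((Nat.prime_dvd_prime_iff_eq hp hq).1 (Nat.dvd_of_mul_dvd_mul_left hp.pos this))

theorem mainTheorem3 (d : ℤ) (hd : Squarefree d) (hd1 : 1 < d)
    (hn : (ramifiedPrimes (quadField d)).ncard = 2)
    (hh : quadClassNumber d = 1 ∨ quadClassNumber d = 2)
    (p₁ : ℕ) (hp : IsLeast (ramifiedPrimes (quadField d)) p₁) :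
    (p₁ ≡ 1 [MOD 4] → quadClassNumber d = 2) ∧
      (p₁ ≡ 3 [MOD 4] → quadClassNumber d = 1) := by
  obtain ⟨F⟩ := exists_algEquiv_quadField (not_isSquare_of_squarefree hd hd1)
  have hreal := isTotallyReal_of_algEquiv (by omega) F
  have hfin : Module.finrank ℚ (quadField d) = 2 := by
    rw [← F.toLinearEquiv.finrank_eq, finrank_eq_two]
  have key (hodd : p₁ % 2 = 1) := exists_eq_mul_of_ramifiedPrimes hd hd1 F hn hp hodd
  refine ⟨fun h4 => hh.resolve_left fun h1 => ?_, fun h4 => hh.resolve_right fun h2 => ?_⟩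
  · have h4 : p₁ % 4 = 1 := h4
    obtain ⟨q, m, hp', hq, hne, hm, hpq⟩ := key (by omega)
    obtain ⟨e⟩ := exists_algEquiv_of_eq_four_mul_add_one hd F hm
    have : IsDomain (QuadraticAlgebra ℤ m 1) := e.toRingEquiv.toMulEquiv.isDomain _
    obtain ⟨ε, hε, -⟩ := exists_fundamental_unit_of_ringEquiv hfin e.toRingEquiv
    have hq4 : q % 4 = 1 := by
      have h5 : ((p₁ * q : ℕ) : ℤ) = 4 * m + 1 := by exact_mod_cast hpq
      have h6 : (p₁ * q) % 4 = 1 := by omega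
      rw [Nat.mul_mod, h4, one_mul, Nat.mod_mod] at h6
      exact h6
    obtain ⟨a, b, hb, hab⟩ := exists_sq_add_sq_eq_mul hp' hq hne h4 hq4
    have hpid := (NumberField.classNumber_eq_one_iff (K := quadField d)).1 h1
    exact not_isPrincipalIdealRing hp' hq hne hpq hb (hab.trans hpq) hε
      (IsPrincipalIdealRing.of_surjective (e.symm : 𝓞 (quadField d) →+* QuadraticAlgebra ℤ m 1)
        e.symm.surjective)
  · have h4 : p₁ % 4 = 3 := h4
    obtain ⟨q, m, hp', hq, hne, hm, hpq⟩ := key (by omega)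
    obtain ⟨e⟩ := exists_algEquiv_of_eq_four_mul_add_one hd F hm
    have : IsDomain (QuadraticAlgebra ℤ m 1) := e.toRingEquiv.toMulEquiv.isDomain _
    obtain ⟨ε, -, hε⟩ := exists_fundamental_unit_of_ringEquiv hfin e.toRingEquiv
    obtain ⟨⟨I, hI⟩, hmul⟩ := exists_not_principal_of_ringEquiv e.toRingEquiv
      (exists_not_principal_of_card_classGroup_eq_two h2)
    exact not_forall_mul_principal hp' hq hne hpq
      (eq_zero_of_norm_eq_neg_sq hp' hq hne hpq h4) hε hI hmul
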